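/- **Model.** There are a finite set of students $\mathcal{I}$, a set of schools, a finite set of types $\mathcal{M}$ and a map $\tau:\mathcal{I}\to\mathcal{M}$; $\mathcal{I}^m=\tau^{-1}(m)$. Each school $s$ has $q_s$ seats and, for each $m\in\mathcal{M}$, a reserve quota $q_s^m\in\mathbb{N}\cup\{0\}$, where $\sum_{m} q_s^m<q_s$ and $q_s^m<|\mathcal{I}^m|$ for every $m$. Each school $s$ ranks the students strictly, by scores that are pairwise distinct. **SimFlex.** Fix a school $s$. It has two subschools, $s^o$ (open seats) and $s^r$ (reserved seats). For disjoint sets $J$ of applicants to $s^o$ and $J'$ of applicants to $s^r$, the choice rule $\mathcal{C}^{SimFlex}$ first assigns, for each $m$, reserved seats to the highest-ranked students in $J'\cap\mathcal{I}^m$, up to the quota $q_s^m$; then it assigns all remaining seats of $s$ as open seats to the highest-ranked students in $J$, until all seats are filled or all of $J$ is admitted. $\mathcal{C}^{SimFlex}(J,J')$ records the chosen students and their seat types. **The rule $\mathcal{C}^*$.** Let $I,I'$ be disjoint sets of students, where those in $I$ report $s^o$–$s^r$ (they rank $s^o$ immediately above $s^r$) and those in $I'$ report $s^r$–$s^o$.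 Run student-proposing deferred acceptance in the economy consisting of $s$ and the students in $I\cup I'$, with $s$ using $\mathcal{C}^{SimFlex}$: in each round, every unassigned student applies to the best subschool in her list that has not rejected her; if $J$ and $J'$ are the students standing at $s^o$ and at $s^r$ (new applicants together with those tentatively admitted in the previous round), the school tentatively admits according to $\mathcal{C}^{SimFlex}(J,J')$ and rejects the others from the subschool at which they stand; the procedure stops when there are no further rejections. The final assignment is $\mathcal{C}^*(I,I')$, and $\mathcal{C}^*\langle I,I'\rangle$ is the set of students chosen in it. **Proposition.** For every school $s$, every pair of disjoint sets of students $(I,I')$ and every $i\in I'$, $$\mathcal{C}^*\langle I,I'\rangle\cap\mathcal{I}^{\tau(i)}\subseteq \mathcal{C}^*\langle I\cup\{i\},\,I'\setminus\{i\}\rangle\cap\mathcal{I}^{\tau(i)}.$$ That is, if one student $i$ switches from reporting $s^r$–$s^o$ to reporting $s^o$–$s^r$ while all other reports stay the same, then every student of the same type as $i$ who was chosen before is still chosen. -/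

import Mathlib

/-- The two kinds of seats: open seats (subschool `s^o`) and reserved seats (subschool `s^r`). -/
inductive SeatType where
  | openSeat : SeatType
  | reservedSeat : SeatType
deriving DecidableEq

instance : Fintype SeatType where
  elems := {SeatType.openSeat, SeatType.reservedSeat}
  complete := by intro t; cases t <;> simp

/-- A school choice environment with reserve quotas (everything but the students' preferences). -/
structure SchoolChoice (Student School MType : Type*) [Fintype Student] [Fintype MType]
    [DecidableEq MType] where
  /-- the type `τ(i)` of student `i` -/
  type : Student → MType
  /-- the number `q_s` of seats of school `s` -/
  capacity : School → ℕ
  /-- the number `q_s^m` of seats which school `s` reserves for type `m` -/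
  reserve : School → MType → ℕ
  /-- the priority score of a student at a school; a higher score is a higher priority -/
  score : School → Student → ℕ
  /-- priorities are strict -/
  score_injective : ∀ s, Function.Injective (score s)
  /-- every school has at least one open seat -/
  sum_reserve_lt : ∀ s, ∑ m, reserve s m < capacity s
  /-- no type fits entirely into the seats reserved for it -/
  reserve_lt_card : ∀ s m, reserve s m < (Finset.univ.filter fun i => type i = m).card

namespace SchoolChoice

/-- The set of chosen students of a set of (student, seat type) assignments. -/
def chosen {Student : Type*} [DecidableEq Student] (μ : Finset (Student × SeatType)) :
    Finset Student :=
  μ.image Prod.fst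

section DeferredAcceptance

variable {Student : Type*} [Fintype Student] [DecidableEq Student]

/-- The students who stand at the subschool with seats of type `t` when the pairs in `R` are the
rejections so far. `pref i` is the list of acceptable subschools of `i`, best first. A student
stands at the best subschool that has not rejected her: she applies there if she was just rejected
elsewhere, and remains there as long as she is tentatively admitted. -/
def applicants (pref : Student → List SeatType) (R : Finset (Student × SeatType))
    (t : SeatType) : Finset Student :=
  Finset.univ.filter fun i => (pref i).find? (fun u => decide ((i, u) ∉ R)) = some t

/-- The school's (tentative) selection in the round that starts with the rejections `R`, when it
uses the choice rule `C`, a function of the applicants to `s^o` and the applicants to `s^r`. -/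
def selection (C : Finset Student → Finset Student → Finset (Student × SeatType))
    (pref : Student → List SeatType) (R : Finset (Student × SeatType)) :
    Finset (Student × SeatType) :=
  C (applicants pref R .openSeat) (applicants pref R .reservedSeat)

/-- One round of deferred acceptance: the applicants who are not selected are rejected by the
subschool at which they stand. -/
def daRound (C : Finset Student → Finset Student → Finset (Student × SeatType))
    (pref : Student → List SeatType) (R : Finset (Student × SeatType)) :
    Finset (Student × SeatType) :=
  R ∪ ((Finset.univ.filter fun p => p.1 ∈ applicants pref R p.2) \ selection C pref R)

/-- The rejections after `n` rounds of deferred acceptance. -/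
def rejections (C : Finset Student → Finset Student → Finset (Student × SeatType))
    (pref : Student → List SeatType) (n : ℕ) : Finset (Student × SeatType) :=
  (daRound C pref)^[n] ∅

/-- The outcome of deferred acceptance with one school, which has an open and a reserved
subschool. After as many rounds as there are pairs of a student and a subschool, no further
rejection occurs, see `daRound_rejections`. -/
def deferredAcceptance (C : Finset Student → Finset Student → Finset (Student × SeatType))
    (pref : Student → List SeatType) : Finset (Student × SeatType) :=
  selection C pref (rejections C pref (Fintype.card (Student × SeatType)))

/-- Deferred acceptance has stopped after `Fintype.card (Student × SeatType)` rounds. -/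
theorem daRound_rejections (C : Finset Student → Finset Student → Finset (Student × SeatType))
    (pref : Student → List SeatType) :
    daRound C pref (rejections C pref (Fintype.card (Student × SeatType))) =
      rejections C pref (Fintype.card (Student × SeatType)) := by
  have step : ∀ n, rejections C pref (n + 1) = daRound C pref (rejections C pref n) := fun n =>
    Function.iterate_succ_apply' _ _ _
  have key : ∀ n, daRound C pref (rejections C pref n) = rejections C pref n ∨
      n ≤ (rejections C pref n).card := by
    intro n
    induction n with
    | zero => exact Or.inr (Nat.zero_le _)
    | succ n ih =>
      by_cases h : daRound C pref (rejections C pref n) = rejections C pref n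
      · left
        rw [step, h, h]
      · right
        have hlt : (rejections C pref n).card < (daRound C pref (rejections C pref n)).card :=
          Finset.card_lt_card
            (Finset.ssubset_iff_subset_ne.2 ⟨Finset.subset_union_left, fun e => h e.symm⟩)
        have hn := ih.resolve_left h
        rw [step]
        omega
  rcases key (Fintype.card (Student × SeatType)) with h | h
  · exact h
  · have hu := (Finset.card_eq_iff_eq_univ _).1 (le_antisymm (Finset.card_le_univ _) h)
    rw [hu]
    exact Finset.univ_subset_iff.1 Finset.subset_union_left

/-- The preferences of the artificial economy in which the students in `I` rank `s^o` above `s^r`,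
the students in `I'` rank `s^r` above `s^o`, and all others are absent. -/
def artificialPref (I I' : Finset Student) (i : Student) : List SeatType :=
  if i ∈ I then [.openSeat, .reservedSeat]
  else if i ∈ I' then [.reservedSeat, .openSeat]
  else []

end DeferredAcceptance

section ChoiceRules

variable {Student School MType : Type*} [Fintype Student] [DecidableEq Student]
  [Fintype MType] [DecidableEq MType]

/-- The set of students of type `m`. -/
def ofType (E : SchoolChoice Student School MType) (m : MType) : Finset Student :=
  Finset.univ.filter fun i => E.type i = m

/-- The `n` highest-ranked students of `A` at school `s` (all of `A` if it has at most `n`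
elements): those with fewer than `n` students of `A` ranked above them. -/
def topRanked (E : SchoolChoice Student School MType) (s : School) (n : ℕ)
    (A : Finset Student) : Finset Student :=
  A.filter fun i => (A.filter fun j => E.score s i < E.score s j).card < n

/-- The students who get a reserved seat under SimFlex when `I'` is the set of applicants to
`s^r`: for each type `m`, the highest-ranked ones of type `m` up to the quota `q_s^m`. -/
def simFlexReserved (E : SchoolChoice Student School MType) (s : School) (I' : Finset Student) :
    Finset Student :=
  Finset.univ.biUnion fun m => E.topRanked s (E.reserve s m) (I' ∩ E.ofType m)

/-- The SimFlex choice rule, for the applicants `I` to `s^o` and the applicants `I'` to `s^r`: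
reserved seats are assigned first, and all remaining seats of the school are assigned as open seats
to the highest-ranked students in `I`. -/
def simFlex (E : SchoolChoice Student School MType) (s : School) (I I' : Finset Student) :
    Finset (Student × SeatType) :=
  (E.topRanked s (E.capacity s - (E.simFlexReserved s I').card) I ×ˢ {SeatType.openSeat}) ∪
    (E.simFlexReserved s I' ×ˢ {SeatType.reservedSeat})

/-- The choice rule `C*` of school `s`: the outcome of deferred acceptance in the artificial economy
of `s` and the students in `I ∪ I'`, where `s` uses the SimFlex choice rule. -/
def cStar (E : SchoolChoice Student School MType) (s : School) (I I' : Finset Student) :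
    Finset (Student × SeatType) :=
  deferredAcceptance (E.simFlex s) (artificialPref I I')

end ChoiceRules

end SchoolChoice

/-! The outcome of deferred acceptance is governed by one number, a cutoff score `c` for the open
seats: `cutoffChosen` collects the participants scoring at least `c` and the winners of reserved
seats when the members of `I` below `c` fall back on those. Deferred acceptance selects the largest
such set that fits into the capacity: its outcome has this form
(`exists_chosen_cStar_eq_cutoffChosen`) and contains every such set that fits
(`cutoffChosen_subset_chosen_cStar`).

Three facts about these sets suffice. Within a type they are closed under passing to better students
(`mem_cutoffChosen_of_score_lt`). Raising the cutoff by one removes at most one student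
(`exists_cutoffChosen_subset_insert_succ`). At a fixed cutoff, the switch of `i` removes nobody and
adds at most one student, who has the type of `i` (`cutoffChosen_subset_switch`,
`type_eq_of_mem_switch`, `card_cutoffChosen_switch_le`).

If the new set fits at the old cutoff, nothing is lost. Otherwise it is too large by exactly one,
and the cutoff rises until one student leaves. Suppose the leaver `j` was chosen before and has the
type of `i`. The added student `z` has the same type and was not chosen before, so `z` ranks below
`j`. But `z` stays, hence so does `j`, a contradiction (`exists_cutoffChosen_switch`). -/

namespace SchoolChoice

set_option linter.unusedSectionVars false

/-! ### Monotonicity and substitutability of the SimFlex choices -/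

section TopRanked

variable {Student School MType : Type*} [Fintype Student] [DecidableEq Student]
  [Fintype MType] [DecidableEq MType] (E : SchoolChoice Student School MType) (s : School)

theorem mem_topRanked {n : ℕ} {A : Finset Student} {j : Student} :
    j ∈ E.topRanked s n A ↔
      j ∈ A ∧ (A.filter fun k => E.score s j < E.score s k).card < n := by
  simp [topRanked]

theorem card_topRanked_le (n : ℕ) (A : Finset Student) : (E.topRanked s n A).card ≤ n := by
  rcases (E.topRanked s n A).eq_empty_or_nonempty with h | h
  · simp [h]
  · obtain ⟨j, hj, hmin⟩ := Finset.exists_min_image _ (E.score s) h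
    have hsub : E.topRanked s n A ⊆ insert j (A.filter fun k => E.score s j < E.score s k) := by
      intro k hk
      rw [Finset.mem_insert, Finset.mem_filter]
      rcases (hmin k hk).lt_or_eq with h1 | h1
      · exact Or.inr ⟨((E.mem_topRanked s).1 hk).1, h1⟩
      · exact Or.inl (E.score_injective s h1).symm
    have h1 := Finset.card_le_card hsub
    have h2 := Finset.card_insert_le j (A.filter fun k => E.score s j < E.score s k)
    have h3 := ((E.mem_topRanked s).1 hj).2
    omega

theorem score_lt_of_mem_topRanked {n : ℕ} {A : Finset Student} {j k : Student} (hj : j ∈ A)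
    (hj' : j ∉ E.topRanked s n A) (hk : k ∈ E.topRanked s n A) : E.score s j < E.score s k := by
  by_contra h
  rw [mem_topRanked] at hj' hk
  refine hj' ⟨hj, lt_of_le_of_lt (Finset.card_le_card ?_) hk.2⟩
  intro l
  simp only [Finset.mem_filter]
  exact fun hl => ⟨hl.1, by omega⟩

/-- The best student left out has at least `n` students of `A` above her, and all of those are
selected. -/
theorem le_card_topRanked {n : ℕ} {A : Finset Student} {j : Student} (hj : j ∈ A)
    (hj' : j ∉ E.topRanked s n A) : n ≤ (E.topRanked s n A).card := by
  obtain ⟨k, hk, hmax⟩ := Finset.exists_max_image (A \ E.topRanked s n A) (E.score s)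
    ⟨j, Finset.mem_sdiff.2 ⟨hj, hj'⟩⟩
  rw [Finset.mem_sdiff] at hk
  have hn : n ≤ (A.filter fun l => E.score s k < E.score s l).card := by
    by_contra h
    exact hk.2 ((E.mem_topRanked s).2 ⟨hk.1, by omega⟩)
  refine hn.trans (Finset.card_le_card ?_)
  intro l hl
  rw [Finset.mem_filter] at hl
  by_contra h
  have := hmax l (Finset.mem_sdiff.2 ⟨hl.1, h⟩)
  omega

theorem card_topRanked_mono (n : ℕ) {A B : Finset Student} (h : A ⊆ B) :
    (E.topRanked s n A).card ≤ (E.topRanked s n B).card := by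
  by_cases hB : B ⊆ E.topRanked s n B
  · exact Finset.card_le_card (((Finset.filter_subset _ _).trans h).trans hB)
  · obtain ⟨j, hj, hj'⟩ := Finset.not_subset.1 hB
    exact (E.card_topRanked_le s n A).trans (E.le_card_topRanked s hj hj')

/-- This makes rejections permanent: the selected students alone, who do not move, already outnumber
`j`. -/
theorem le_card_above_topRanked {n : ℕ} {A : Finset Student} {j : Student}
    (h : n ≤ (A.filter fun k => E.score s j < E.score s k).card) :
    n ≤ ((E.topRanked s n A).filter fun k => E.score s j < E.score s k).card := by
  by_cases hA : (A.filter fun k => E.score s j < E.score s k) ⊆ E.topRanked s n A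
  · refine h.trans (Finset.card_le_card ?_)
    intro k hk
    exact Finset.mem_filter.2 ⟨hA hk, (Finset.mem_filter.1 hk).2⟩
  · obtain ⟨k, hk, hk'⟩ := Finset.not_subset.1 hA
    rw [Finset.mem_filter] at hk
    rw [Finset.filter_true_of_mem]
    · exact E.le_card_topRanked s hk.1 hk'
    · exact fun l hl => hk.2.trans (E.score_lt_of_mem_topRanked s hk.1 hk' hl)

/-- The students of `B` who have the type of `j` and are ranked above `j`. -/
def typeRivals (B : Finset Student) (j : Student) : Finset Student :=
  (B ∩ E.ofType (E.type j)).filter fun k => E.score s j < E.score s k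

theorem mem_typeRivals {B : Finset Student} {j k : Student} :
    k ∈ E.typeRivals s B j ↔ k ∈ B ∧ E.type k = E.type j ∧ E.score s j < E.score s k := by
  simp [typeRivals, ofType, and_assoc]

theorem typeRivals_mono {A B : Finset Student} (h : A ⊆ B) (j : Student) :
    E.typeRivals s A j ⊆ E.typeRivals s B j := by
  intro k
  simp only [mem_typeRivals]
  exact fun hk => ⟨h hk.1, hk.2⟩

theorem mem_simFlexReserved {B : Finset Student} {j : Student} :
    j ∈ E.simFlexReserved s B ↔
      j ∈ B ∧ (E.typeRivals s B j).card < E.reserve s (E.type j) := by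
  simp only [simFlexReserved, Finset.mem_biUnion, Finset.mem_univ, true_and, mem_topRanked,
    typeRivals, Finset.mem_inter]
  constructor
  · rintro ⟨m, ⟨hj, hm⟩, h⟩
    obtain rfl : E.type j = m := by simpa [ofType] using hm
    exact ⟨hj, h⟩
  · rintro ⟨hj, h⟩
    exact ⟨_, ⟨hj, by simp [ofType]⟩, h⟩

theorem simFlexReserved_subset (B : Finset Student) : E.simFlexReserved s B ⊆ B :=
  fun _ hj => ((E.mem_simFlexReserved s).1 hj).1

/-- Substitutability: removing competitors removes rivals. -/
theorem mem_simFlexReserved_of_subset {A B : Finset Student} (h : A ⊆ B) {j : Student}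
    (hj : j ∈ A) (hB : j ∈ E.simFlexReserved s B) : j ∈ E.simFlexReserved s A := by
  rw [mem_simFlexReserved] at hB ⊢
  exact ⟨hj, lt_of_le_of_lt (Finset.card_le_card (E.typeRivals_mono s h j)) hB.2⟩

theorem card_simFlexReserved (B : Finset Student) :
    (E.simFlexReserved s B).card =
      ∑ m, (E.topRanked s (E.reserve s m) (B ∩ E.ofType m)).card := by
  refine Finset.card_biUnion fun m _ m' _ hne => Finset.disjoint_left.2 fun j hj hj' => hne ?_
  rw [mem_topRanked] at hj hj'
  have h1 : E.type j = m := by simpa [ofType] using (Finset.mem_inter.1 hj.1).2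
  have h2 : E.type j = m' := by simpa [ofType] using (Finset.mem_inter.1 hj'.1).2
  exact h1.symm.trans h2

theorem card_simFlexReserved_mono {A B : Finset Student} (h : A ⊆ B) :
    (E.simFlexReserved s A).card ≤ (E.simFlexReserved s B).card := by
  rw [card_simFlexReserved, card_simFlexReserved]
  exact Finset.sum_le_sum fun m _ =>
    E.card_topRanked_mono s _ (Finset.inter_subset_inter_right h)

theorem card_simFlexReserved_lt (B : Finset Student) :
    (E.simFlexReserved s B).card < E.capacity s := by
  rw [card_simFlexReserved]
  exact lt_of_le_of_lt (Finset.sum_le_sum fun m _ => E.card_topRanked_le s _ _)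
    (E.sum_reserve_lt s)

/-- Choosing again from the winners alone keeps all of them. Hence the number of filled reserved
seats cannot drop between rounds, although rejected applicants leave. -/
theorem card_simFlexReserved_le_of_subset {A B : Finset Student}
    (h : E.simFlexReserved s A ⊆ B) :
    (E.simFlexReserved s A).card ≤ (E.simFlexReserved s B).card := by
  refine le_trans (Finset.card_le_card ?_) (E.card_simFlexReserved_mono s h)
  exact fun j hj => E.mem_simFlexReserved_of_subset s (E.simFlexReserved_subset s A) hj hj

theorem le_card_typeRivals_simFlexReserved {B : Finset Student} {j : Student}
    (h : E.reserve s (E.type j) ≤ (E.typeRivals s B j).card) :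
    E.reserve s (E.type j) ≤ (E.typeRivals s (E.simFlexReserved s B) j).card := by
  refine (E.le_card_above_topRanked s h).trans (Finset.card_le_card ?_)
  intro k hk
  rw [Finset.mem_filter] at hk
  have hk1 := ((E.mem_topRanked s).1 hk.1).1
  have hkm : E.type k = E.type j := by simpa [ofType] using (Finset.mem_inter.1 hk1).2
  rw [mem_typeRivals]
  exact ⟨Finset.mem_biUnion.2 ⟨_, Finset.mem_univ _, hk.1⟩, hkm, hk.2⟩

theorem mem_simFlex_open {J J' : Finset Student} {j : Student} :
    (j, SeatType.openSeat) ∈ E.simFlex s J J' ↔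
      j ∈ E.topRanked s (E.capacity s - (E.simFlexReserved s J').card) J := by
  simp [simFlex]

theorem mem_simFlex_reserved {J J' : Finset Student} {j : Student} :
    (j, SeatType.reservedSeat) ∈ E.simFlex s J J' ↔ j ∈ E.simFlexReserved s J' := by
  simp [simFlex]

end TopRanked

/-! ### Where students stand, and induction over rounds -/

section Applicants

variable {Student : Type*} [Fintype Student] [DecidableEq Student]

theorem mem_applicants_open {I I' : Finset Student} (hd : Disjoint I I')
    {R : Finset (Student × SeatType)} {j : Student} :
    j ∈ applicants (artificialPref I I') R .openSeat ↔
      (j, SeatType.openSeat) ∉ R ∧ (j ∈ I ∨ j ∈ I' ∧ (j, SeatType.reservedSeat) ∈ R) := by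
  have := fun h : j ∈ I => Finset.disjoint_left.1 hd h
  by_cases h1 : j ∈ I <;> by_cases h2 : j ∈ I' <;>
    by_cases h3 : (j, SeatType.openSeat) ∈ R <;>
    by_cases h4 : (j, SeatType.reservedSeat) ∈ R <;>
    simp_all [applicants, artificialPref, List.find?]

theorem mem_applicants_reserved {I I' : Finset Student} (hd : Disjoint I I')
    {R : Finset (Student × SeatType)} {j : Student} :
    j ∈ applicants (artificialPref I I') R .reservedSeat ↔
      (j, SeatType.reservedSeat) ∉ R ∧ (j ∈ I' ∨ j ∈ I ∧ (j, SeatType.openSeat) ∈ R) := by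
  have := fun h : j ∈ I => Finset.disjoint_left.1 hd h
  by_cases h1 : j ∈ I <;> by_cases h2 : j ∈ I' <;>
    by_cases h3 : (j, SeatType.openSeat) ∈ R <;>
    by_cases h4 : (j, SeatType.reservedSeat) ∈ R <;>
    simp_all [applicants, artificialPref, List.find?]

theorem mem_daRound {C : Finset Student → Finset Student → Finset (Student × SeatType)}
    {pref : Student → List SeatType} {R : Finset (Student × SeatType)} {p : Student × SeatType} :
    p ∈ daRound C pref R ↔
      p ∈ R ∨ p.1 ∈ applicants pref R p.2 ∧ p ∉ selection C pref R := by
  simp [daRound]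

theorem rejections_induction {C : Finset Student → Finset Student → Finset (Student × SeatType)}
    {pref : Student → List SeatType} {P : Finset (Student × SeatType) → Prop} (h0 : P ∅)
    (hs : ∀ R, P R → P (daRound C pref R)) (n : ℕ) : P (rejections C pref n) := by
  induction n with
  | zero => exact h0
  | succ n ih =>
    rw [rejections, Function.iterate_succ_apply']
    exact hs _ ih

end Applicants

/-! ### Chosen sets described by a cutoff for the open seats -/

section Cutoff

variable {Student School MType : Type*} [Fintype Student] [DecidableEq Student]
  [Fintype MType] [DecidableEq MType] (E : SchoolChoice Student School MType) (s : School)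

/-- The students who apply for a reserved seat when the open seats are closed to scores
below `c`. -/
def reservedDemand (I I' : Finset Student) (c : ℕ) : Finset Student :=
  I' ∪ I.filter fun j => E.score s j < c

/-- The students who are chosen when the open seats go to scores of at least `c`. -/
def cutoffChosen (I I' : Finset Student) (c : ℕ) : Finset Student :=
  ((I ∪ I').filter fun j => c ≤ E.score s j) ∪ E.simFlexReserved s (E.reservedDemand s I I' c)

variable {E s} {I I' : Finset Student} {c : ℕ} {j k : Student}

theorem mem_reservedDemand :
    j ∈ E.reservedDemand s I I' c ↔ j ∈ I' ∨ j ∈ I ∧ E.score s j < c := by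
  simp [reservedDemand]

theorem mem_cutoffChosen :
    j ∈ E.cutoffChosen s I I' c ↔ (j ∈ I ∨ j ∈ I') ∧ c ≤ E.score s j ∨
      j ∈ E.simFlexReserved s (E.reservedDemand s I I' c) := by
  simp [cutoffChosen]

theorem mem_union_of_mem_cutoffChosen (h : j ∈ E.cutoffChosen s I I' c) : j ∈ I ∨ j ∈ I' := by
  rcases mem_cutoffChosen.1 h with h | h
  · exact h.1
  · rcases mem_reservedDemand.1 (E.simFlexReserved_subset s _ h) with h | h
    · exact Or.inr h
    · exact Or.inl h.1

/-- Below the cutoff every participant competes for reserved seats, whichever list she reports, and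
there `k` has no more rivals than `j`. -/
theorem mem_cutoffChosen_of_score_lt (hj : j ∈ E.cutoffChosen s I I' c)
    (hk : k ∈ I ∨ k ∈ I') (ht : E.type k = E.type j) (hlt : E.score s j < E.score s k) :
    k ∈ E.cutoffChosen s I I' c := by
  rw [mem_cutoffChosen] at hj ⊢
  by_cases hc : c ≤ E.score s k
  · exact Or.inl ⟨hk, hc⟩
  · right
    have hj := (E.mem_simFlexReserved s).1 (hj.resolve_left fun h => by omega)
    refine (E.mem_simFlexReserved s).2 ⟨mem_reservedDemand.2 ?_, ?_⟩
    · exact hk.symm.imp_right fun h => ⟨h, by omega⟩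
    · rw [ht]
      refine lt_of_le_of_lt (Finset.card_le_card fun l => ?_) hj.2
      simp only [mem_typeRivals]
      exact fun hl => ⟨hl.1, hl.2.1.trans ht, hlt.trans hl.2.2⟩

theorem cutoffChosen_succ_subset :
    E.cutoffChosen s I I' (c + 1) ⊆ E.cutoffChosen s I I' c := by
  intro j hj
  have hU := mem_union_of_mem_cutoffChosen hj
  rw [mem_cutoffChosen] at hj ⊢
  by_cases hc : c ≤ E.score s j
  · exact Or.inl ⟨hU, hc⟩
  · right
    refine E.mem_simFlexReserved_of_subset s (B := E.reservedDemand s I I' (c + 1)) ?_ ?_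
      (hj.resolve_left fun h => by omega)
    · intro k
      simp only [mem_reservedDemand]
      exact Or.imp_right fun h => ⟨h.1, by omega⟩
    · exact mem_reservedDemand.2 (hU.symm.imp_right fun h => ⟨h, by omega⟩)

theorem cutoffChosen_antitone : Antitone (E.cutoffChosen s I I') :=
  antitone_nat_of_succ_le fun _ => cutoffChosen_succ_subset

/-- Of two students of one type who are not both chosen at the cutoff `c + 1`, the better one stays
chosen. -/
theorem mem_cutoffChosen_succ_of_score_lt (hj : j ∈ E.cutoffChosen s I I' c)
    (hk : k ∈ E.cutoffChosen s I I' c) (ht : E.type k = E.type j)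
    (hlt : E.score s j < E.score s k) : k ∈ E.cutoffChosen s I I' (c + 1) := by
  have hU := mem_union_of_mem_cutoffChosen hk
  have hUj := mem_union_of_mem_cutoffChosen hj
  rw [mem_cutoffChosen] at hj ⊢
  by_cases hc : c + 1 ≤ E.score s k
  · exact Or.inl ⟨hU, hc⟩
  right
  have hj := (E.mem_simFlexReserved s).1 (hj.resolve_left fun h => by omega)
  refine (E.mem_simFlexReserved s).2 ⟨mem_reservedDemand.2 ?_, ?_⟩
  · exact hU.symm.imp_right fun h => ⟨h, by omega⟩
  rw [ht]
  -- If `k` is at the cutoff, her rivals score more than `c`, so the rise of the cutoff brings none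
  -- of them into the demand.
  by_cases hkc : E.score s k = c
  · refine lt_of_le_of_lt (Finset.card_le_card fun l => ?_) hj.2
    simp only [mem_typeRivals, mem_reservedDemand]
    rintro ⟨hl, hl1, hl2⟩
    exact ⟨hl.imp_right fun h => ⟨h.1, by omega⟩, hl1.trans ht, hlt.trans hl2⟩
  · have hkm : k ∈ E.typeRivals s (E.reservedDemand s I I' c) j := by
      refine (E.mem_typeRivals s).2 ⟨mem_reservedDemand.2 ?_, ht, hlt⟩
      exact hU.symm.imp_right fun h => ⟨h, by omega⟩
    -- Only the student `x` with score `c` can newly enter the demand. Even if she becomes a rival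
    -- of `k`, this is offset by `k`, who is a rival of `j` but not of herself.
    by_cases hx : ∃ x, E.score s x = c
    · obtain ⟨x, hx⟩ := hx
      have hsub : E.typeRivals s (E.reservedDemand s I I' (c + 1)) k ⊆
          insert x ((E.typeRivals s (E.reservedDemand s I I' c) j).erase k) := by
        intro l
        simp only [mem_typeRivals, mem_reservedDemand, Finset.mem_insert, Finset.mem_erase]
        rintro ⟨hl, hl1, hl2⟩
        by_cases hlx : E.score s l = c
        · exact Or.inl (E.score_injective s (hlx.trans hx.symm))
        · refine Or.inr ⟨?_, hl.imp_right fun h => ⟨h.1, by omega⟩, hl1.trans ht, hlt.trans hl2⟩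
          rintro rfl
          omega
      have h1 := Finset.card_le_card hsub
      have h2 := Finset.card_insert_le x
        ((E.typeRivals s (E.reservedDemand s I I' c) j).erase k)
      have h3 := Finset.card_erase_add_one hkm
      omega
    · refine lt_of_le_of_lt (Finset.card_le_card fun l => ?_) hj.2
      simp only [mem_typeRivals, mem_reservedDemand]
      rintro ⟨hl, hl1, hl2⟩
      have hlc : E.score s l ≠ c := fun h => hx ⟨l, h⟩
      exact ⟨hl.imp_right fun h => ⟨h.1, by omega⟩, hl1.trans ht, hlt.trans hl2⟩

/-- A student who loses her seat when the cutoff rises has the type of the student at the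
cutoff. -/
theorem exists_score_eq_of_mem_sdiff (hj : j ∈ E.cutoffChosen s I I' c)
    (hj' : j ∉ E.cutoffChosen s I I' (c + 1)) : ∃ x, E.score s x = c ∧ E.type x = E.type j := by
  by_contra! hx
  have hjc : E.score s j ≠ c := fun h => hx j h rfl
  rw [mem_cutoffChosen] at hj hj'
  apply hj'
  rcases hj with hj | hj
  · exact Or.inl ⟨hj.1, by omega⟩
  · right
    rw [mem_simFlexReserved, mem_reservedDemand] at hj ⊢
    refine ⟨hj.1.imp_right fun h => ⟨h.1, by omega⟩,
      lt_of_le_of_lt (Finset.card_le_card fun l => ?_) hj.2⟩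
    simp only [mem_typeRivals, mem_reservedDemand]
    rintro ⟨hl, hl1, hl2⟩
    have hlc : E.score s l ≠ c := fun h => hx l h hl1
    exact ⟨hl.imp_right fun h => ⟨h.1, by omega⟩, hl1, hl2⟩

/-- Scores are distinct, so all losers share the type of the one student at the cutoff; of two
losers of one type the better would have stayed. -/
theorem eq_of_mem_sdiff_cutoffChosen (hj : j ∈ E.cutoffChosen s I I' c)
    (hj' : j ∉ E.cutoffChosen s I I' (c + 1)) (hk : k ∈ E.cutoffChosen s I I' c)
    (hk' : k ∉ E.cutoffChosen s I I' (c + 1)) : j = k := by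
  obtain ⟨x, hx, hxj⟩ := exists_score_eq_of_mem_sdiff hj hj'
  obtain ⟨y, hy, hyk⟩ := exists_score_eq_of_mem_sdiff hk hk'
  obtain rfl : x = y := E.score_injective s (hx.trans hy.symm)
  have ht : E.type k = E.type j := hyk.symm.trans hxj
  rcases lt_trichotomy (E.score s j) (E.score s k) with h | h | h
  · exact absurd (mem_cutoffChosen_succ_of_score_lt hj hk ht h) hk'
  · exact E.score_injective s h
  · exact absurd (mem_cutoffChosen_succ_of_score_lt hk hj ht.symm h) hj'

theorem exists_cutoffChosen_subset_insert_succ (h : (E.cutoffChosen s I I' c).Nonempty) :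
    ∃ y, E.cutoffChosen s I I' c ⊆ insert y (E.cutoffChosen s I I' (c + 1)) := by
  by_cases hs : E.cutoffChosen s I I' c ⊆ E.cutoffChosen s I I' (c + 1)
  -- Nobody leaves, so any `y` will do.
  · exact ⟨h.choose, hs.trans (Finset.subset_insert _ _)⟩
  · obtain ⟨y, hy, hy'⟩ := Finset.not_subset.1 hs
    refine ⟨y, fun k hk => Finset.mem_insert.2 ?_⟩
    by_cases hk' : k ∈ E.cutoffChosen s I I' (c + 1)
    · exact Or.inr hk'
    · exact Or.inl (eq_of_mem_sdiff_cutoffChosen hk hk' hy hy')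

theorem exists_card_cutoffChosen_le (I I' : Finset Student) (c₀ : ℕ) :
    ∃ c, c₀ ≤ c ∧ (E.cutoffChosen s I I' c).card ≤ E.capacity s := by
  -- Above all scores only holders of reserved seats are chosen, and they are fewer than the
  -- capacity.
  refine ⟨c₀ + (Finset.univ.sup (E.score s) + 1), by omega, ?_⟩
  refine le_trans (Finset.card_le_card fun j hj => ?_) (E.card_simFlexReserved_lt s
    (E.reservedDemand s I I' (c₀ + (Finset.univ.sup (E.score s) + 1)))).le
  refine (mem_cutoffChosen.1 hj).resolve_left fun h => ?_
  have := Finset.le_sup (f := E.score s) (Finset.mem_univ j)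
  omega

/-- A claim through the cutoff does not depend on the reported list, and the switch can only shrink
the demand for reserved seats. -/
theorem cutoffChosen_subset_switch (hi : j ∈ I') :
    E.cutoffChosen s I I' c ⊆ E.cutoffChosen s (I ∪ {j}) (I' \ {j}) c := by
  intro k hk
  have hU := mem_union_of_mem_cutoffChosen hk
  rw [mem_cutoffChosen] at hk ⊢
  by_cases hc : c ≤ E.score s k
  · left
    refine ⟨?_, hc⟩
    simp only [Finset.mem_union, Finset.mem_sdiff, Finset.mem_singleton]
    tauto
  · right
    refine E.mem_simFlexReserved_of_subset s (B := E.reservedDemand s I I' c) ?_ ?_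
      (hk.resolve_left fun h => hc h.2)
    · intro l
      simp only [mem_reservedDemand, Finset.mem_union, Finset.mem_sdiff, Finset.mem_singleton]
      rintro (h | ⟨h | rfl, h'⟩)
      · exact Or.inl h.1
      · exact Or.inr ⟨h, h'⟩
      · exact Or.inl hi
    · simp only [mem_reservedDemand, Finset.mem_union, Finset.mem_sdiff, Finset.mem_singleton]
      have : E.score s k < c := by omega
      tauto

/-- The switch affects only the competition for the seats reserved for the type of `j`. -/
theorem type_eq_of_mem_switch (hi : j ∈ I')
    (hk : k ∈ E.cutoffChosen s (I ∪ {j}) (I' \ {j}) c) (hk' : k ∉ E.cutoffChosen s I I' c) :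
    E.type k = E.type j := by
  by_contra ht
  apply hk'
  rw [mem_cutoffChosen] at hk ⊢
  have hkj : k ≠ j := by rintro rfl; exact ht rfl
  simp only [mem_simFlexReserved, mem_reservedDemand, Finset.mem_union, Finset.mem_sdiff,
    Finset.mem_singleton, hkj, or_false, not_false_eq_true, and_true] at hk ⊢
  refine hk.imp_right fun h => ⟨h.1, lt_of_le_of_lt (Finset.card_le_card fun l => ?_) h.2⟩
  simp only [mem_typeRivals, mem_reservedDemand, Finset.mem_union, Finset.mem_sdiff,
    Finset.mem_singleton]
  rintro ⟨hl, hl1, hl2⟩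
  have hlj : l ≠ j := by rintro rfl; exact ht hl1.symm
  exact ⟨by tauto, hl1, hl2⟩

/-- Undoing the switch returns at most the rival `j` to `l`. Since `l` is a rival of `k` but not of
herself, there is room for one more. Hence of two students of one type, at most the worse can owe
her seat to the switch. -/
theorem mem_cutoffChosen_of_switch_of_score_lt {l : Student} (hi : j ∈ I')
    (hk : k ∈ E.cutoffChosen s (I ∪ {j}) (I' \ {j}) c)
    (hl : l ∈ E.cutoffChosen s (I ∪ {j}) (I' \ {j}) c) (ht : E.type l = E.type k)
    (hlt : E.score s k < E.score s l) : l ∈ E.cutoffChosen s I I' c := by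
  have hU : ∀ x, x ∈ E.cutoffChosen s (I ∪ {j}) (I' \ {j}) c → x ∈ I ∨ x ∈ I' := by
    intro x hx
    have := mem_union_of_mem_cutoffChosen hx
    simp only [Finset.mem_union, Finset.mem_sdiff, Finset.mem_singleton] at this
    rcases this with (h | rfl) | h
    · exact Or.inl h
    · exact Or.inr hi
    · exact Or.inr h.1
  have hlU := hU l hl
  rw [mem_cutoffChosen] at hk ⊢
  by_cases hc : c ≤ E.score s l
  · exact Or.inl ⟨hlU, hc⟩
  right
  have hk := (E.mem_simFlexReserved s).1 (hk.resolve_left fun h => by omega)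
  have hlD : l ∈ E.reservedDemand s I I' c :=
    mem_reservedDemand.2 (hlU.symm.imp_right fun h => ⟨h, by omega⟩)
  refine (E.mem_simFlexReserved s).2 ⟨hlD, ?_⟩
  rw [ht]
  by_cases hlj : l = j
  · subst hlj
    refine lt_of_le_of_lt (Finset.card_le_card fun x => ?_) hk.2
    simp only [mem_typeRivals, mem_reservedDemand, Finset.mem_union, Finset.mem_sdiff,
      Finset.mem_singleton]
    rintro ⟨hx, hx1, hx2⟩
    have hxl : x ≠ l := by rintro rfl; omega
    exact ⟨by tauto, hx1.trans ht, hlt.trans hx2⟩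
  · have hlm : l ∈ E.typeRivals s (E.reservedDemand s (I ∪ {j}) (I' \ {j}) c) k := by
      have : E.score s l < c := by omega
      simp only [mem_typeRivals, mem_reservedDemand, Finset.mem_union, Finset.mem_sdiff,
        Finset.mem_singleton]
      exact ⟨by tauto, ht, hlt⟩
    have hsub : E.typeRivals s (E.reservedDemand s I I' c) l ⊆
        insert j ((E.typeRivals s (E.reservedDemand s (I ∪ {j}) (I' \ {j}) c) k).erase l) := by
      intro x
      simp only [mem_typeRivals, mem_reservedDemand, Finset.mem_insert, Finset.mem_erase,
        Finset.mem_union, Finset.mem_sdiff, Finset.mem_singleton]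
      rintro ⟨hx, hx1, hx2⟩
      by_cases hxj : x = j
      · exact Or.inl hxj
      · refine Or.inr ⟨?_, by tauto, hx1.trans ht, hlt.trans hx2⟩
        rintro rfl
        omega
    have h1 := Finset.card_le_card hsub
    have h2 := Finset.card_insert_le j
      ((E.typeRivals s (E.reservedDemand s (I ∪ {j}) (I' \ {j}) c) k).erase l)
    have h3 := Finset.card_erase_add_one hlm
    omega

theorem card_cutoffChosen_switch_le (hi : j ∈ I') :
    (E.cutoffChosen s (I ∪ {j}) (I' \ {j}) c).card ≤ (E.cutoffChosen s I I' c).card + 1 := by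
  have h1 : (E.cutoffChosen s (I ∪ {j}) (I' \ {j}) c \ E.cutoffChosen s I I' c).card ≤ 1 := by
    refine Finset.card_le_one.2 fun k hk l hl => ?_
    rw [Finset.mem_sdiff] at hk hl
    have ht : E.type l = E.type k :=
      (type_eq_of_mem_switch hi hl.1 hl.2).trans (type_eq_of_mem_switch hi hk.1 hk.2).symm
    rcases lt_trichotomy (E.score s k) (E.score s l) with h | h | h
    · exact absurd (mem_cutoffChosen_of_switch_of_score_lt hi hk.1 hl.1 ht h) hl.2
    · exact E.score_injective s h
    · exact absurd (mem_cutoffChosen_of_switch_of_score_lt hi hl.1 hk.1 ht.symm h) hk.2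
  have h2 := Finset.card_sdiff_add_card_eq_card (cutoffChosen_subset_switch (E := E) (s := s)
    (I := I) (c := c) hi)
  omega

/-- If `i` switches from `s^r`-`s^o` to `s^o`-`s^r`, then there is a cutoff at which the capacity
suffices and no student of the type of `i` loses her seat. -/
theorem exists_cutoffChosen_switch {i : Student} (hi : i ∈ I')
    (hc : (E.cutoffChosen s I I' c).card ≤ E.capacity s) :
    ∃ c', (E.cutoffChosen s (I ∪ {i}) (I' \ {i}) c').card ≤ E.capacity s ∧
      ∀ j ∈ E.cutoffChosen s I I' c, E.type j = E.type i →
        j ∈ E.cutoffChosen s (I ∪ {i}) (I' \ {i}) c' := by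
  classical
  set N := E.cutoffChosen s (I ∪ {i}) (I' \ {i}) with hN
  have hex := exists_card_cutoffChosen_le (E := E) (s := s) (I ∪ {i}) (I' \ {i}) c
  obtain ⟨hle, hcap⟩ := Nat.find_spec hex
  have hmin := fun d => Nat.find_min hex (m := d)
  set c' := Nat.find hex
  refine ⟨c', hcap, fun j hj htj => ?_⟩
  have hsub : E.cutoffChosen s I I' c ⊆ N c := cutoffChosen_subset_switch hi
  rcases hle.eq_or_lt with heq | hlt
  · rw [← heq]
    exact hsub hj
  obtain ⟨d, hd⟩ : ∃ d, c' = d + 1 := ⟨c' - 1, by omega⟩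
  have hNd : E.capacity s < (N d).card := by
    by_contra h
    exact hmin d (by omega) ⟨by omega, by rw [← hN]; omega⟩
  have hNc : (N c).card ≤ (E.cutoffChosen s I I' c).card + 1 := card_cutoffChosen_switch_le hi
  have hdc : N d ⊆ N c := cutoffChosen_antitone (by omega)
  -- `N d` exceeds the capacity and `N c` exceeds it by at most one, so both have exactly one
  -- student too many.
  have heq : N d = N c := Finset.eq_of_subset_of_card_le hdc (by omega)
  have hne : (N d).Nonempty := Finset.card_pos.1 (by omega)
  obtain ⟨y, hy⟩ := exists_cutoffChosen_subset_insert_succ hne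
  rw [hd]
  by_contra hjn
  have hjy : j = y := (Finset.mem_insert.1 (hy (heq.symm.subset (hsub hj)))).resolve_right hjn
  subst hjy
  -- the student added by the switch is ranked below `j` and hence would lose her seat as well
  obtain ⟨z, hz, hz'⟩ := Finset.exists_mem_notMem_of_card_lt_card
    (show (E.cutoffChosen s I I' c).card < (N c).card by rw [← heq]; omega)
  have htz := type_eq_of_mem_switch hi hz hz'
  have hzj : z ≠ j := by rintro rfl; exact hz' hj
  have hzs : z ∈ N (d + 1) := (Finset.mem_insert.1 (hy (heq.symm.subset hz))).resolve_left hzj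
  have hzU : z ∈ I ∨ z ∈ I' := by
    have := mem_union_of_mem_cutoffChosen hz
    simp only [Finset.mem_union, Finset.mem_sdiff, Finset.mem_singleton] at this
    rcases this with (h | rfl) | h
    · exact Or.inl h
    · exact Or.inr hi
    · exact Or.inr h.1
  rcases lt_trichotomy (E.score s z) (E.score s j) with h | h | h
  · exact hjn (mem_cutoffChosen_of_score_lt hzs
      (mem_union_of_mem_cutoffChosen (hsub hj)) (htj.trans htz.symm) h)
  · exact hzj (E.score_injective s h)
  · exact hz' (mem_cutoffChosen_of_score_lt hj hzU (htz.trans htj.symm) h)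

end Cutoff

/-! ### Deferred acceptance selects the largest cutoff set that fits -/

section Outcome

variable {Student School MType : Type*} [Fintype Student] [DecidableEq Student]
  [Fintype MType] [DecidableEq MType] {E : SchoolChoice Student School MType} {s : School}
  {I I' : Finset Student}

theorem not_mem_selection_open {R : Finset (Student × SeatType)} {pref : Student → List SeatType}
    {j : Student} (hj : j ∈ applicants pref R .openSeat) :
    (j, SeatType.openSeat) ∉ selection (E.simFlex s) pref R ↔
      E.capacity s - (E.simFlexReserved s (applicants pref R .reservedSeat)).card ≤
        ((applicants pref R .openSeat).filter fun k => E.score s j < E.score s k).card := by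
  rw [selection, mem_simFlex_open, mem_topRanked]
  simp [hj]

theorem not_mem_selection_reserved {R : Finset (Student × SeatType)}
    {pref : Student → List SeatType} {j : Student} (hj : j ∈ applicants pref R .reservedSeat) :
    (j, SeatType.reservedSeat) ∉ selection (E.simFlex s) pref R ↔
      E.reserve s (E.type j) ≤
        (E.typeRivals s (applicants pref R .reservedSeat) j).card := by
  rw [selection, mem_simFlex_reserved, mem_simFlexReserved]
  simp [hj]

/-- Deferred acceptance never rejects a student from a seat which she gets at a cutoff for which
the capacity suffices. -/
theorem rejections_of_card_cutoffChosen_le (hd : Disjoint I I') {c : ℕ}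
    (hc : (E.cutoffChosen s I I' c).card ≤ E.capacity s) (n : ℕ) :
    (∀ j, (j, SeatType.openSeat) ∈ rejections (E.simFlex s) (artificialPref I I') n →
      E.score s j < c) ∧
    ∀ j, (j, SeatType.reservedSeat) ∈ rejections (E.simFlex s) (artificialPref I I') n →
      j ∉ E.simFlexReserved s (E.reservedDemand s I I' c) := by
  refine rejections_induction (P := fun R => (∀ j, (j, SeatType.openSeat) ∈ R →
    E.score s j < c) ∧ ∀ j, (j, SeatType.reservedSeat) ∈ R →
      j ∉ E.simFlexReserved s (E.reservedDemand s I I' c)) (by simp) ?_ n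
  rintro R ⟨ho, hr⟩
  have hJ' : applicants (artificialPref I I') R .reservedSeat ⊆ E.reservedDemand s I I' c := by
    intro j hj
    rw [mem_applicants_reserved hd] at hj
    exact mem_reservedDemand.2 (hj.2.imp_right fun h => ⟨h.1, ho j h.2⟩)
  constructor
  · intro j hj
    rcases mem_daRound.1 hj with hj | ⟨hja, hj⟩
    · exact ho j hj
    by_contra hjc
    replace hj := (not_mem_selection_open (E := E) (s := s) (j := j) hja).1 hj
    set J := applicants (artificialPref I I') R .openSeat with hJ
    set J' := applicants (artificialPref I I') R .reservedSeat
    -- If `j` were rejected, then `j`, the open applicants above her and the winners of reserved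
    -- seats at `c` would together exceed the capacity. No one is counted twice: an open applicant
    -- from `I'` was rejected by `s^r`, so by induction she wins no reserved seat at `c`.
    have hdisj : Disjoint (insert j (J.filter fun k => E.score s j < E.score s k))
        (E.simFlexReserved s (E.reservedDemand s I I' c)) := by
      refine Finset.disjoint_left.2 fun k hk hk' => ?_
      have hkJ : k ∈ J ∧ c ≤ E.score s k := by
        rcases Finset.mem_insert.1 hk with rfl | hk
        · exact ⟨hja, by omega⟩
        · rw [Finset.mem_filter] at hk
          exact ⟨hk.1, by omega⟩
      rw [hJ, mem_applicants_open hd] at hkJ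
      rcases hkJ.1.2 with h | h
      · rcases mem_reservedDemand.1 (E.simFlexReserved_subset s _ hk') with h' | h'
        · exact Finset.disjoint_left.1 hd h h'
        · omega
      · exact hr k h.2 hk'
    have hsub : insert j (J.filter fun k => E.score s j < E.score s k) ∪
        E.simFlexReserved s (E.reservedDemand s I I' c) ⊆ E.cutoffChosen s I I' c := by
      refine Finset.union_subset (fun k hk => mem_cutoffChosen.2 (Or.inl ?_))
        Finset.subset_union_right
      have hkJ : k ∈ J ∧ c ≤ E.score s k := by
        rcases Finset.mem_insert.1 hk with rfl | hk
        · exact ⟨hja, by omega⟩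
        · rw [Finset.mem_filter] at hk
          exact ⟨hk.1, by omega⟩
      rw [hJ, mem_applicants_open hd] at hkJ
      exact ⟨hkJ.1.2.imp_right And.left, hkJ.2⟩
    have h1 := Finset.card_le_card hsub
    rw [Finset.card_union_of_disjoint hdisj, Finset.card_insert_of_notMem (by simp)] at h1
    have h2 := E.card_simFlexReserved_mono s hJ'
    omega
  · intro j hj
    rcases mem_daRound.1 hj with hj | ⟨hja, hj⟩
    · exact hr j hj
    · intro hjr
      apply hj
      rw [selection, mem_simFlex_reserved]
      exact E.mem_simFlexReserved_of_subset s hJ' hja hjr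

/-- A seat from which a student was rejected is taken by students ranked above her. -/
theorem le_card_applicants_of_mem_rejections (hd : Disjoint I I') (n : ℕ) :
    let R := rejections (E.simFlex s) (artificialPref I I') n
    (∀ j, (j, SeatType.openSeat) ∈ R →
      E.capacity s -
          (E.simFlexReserved s (applicants (artificialPref I I') R .reservedSeat)).card ≤
        ((applicants (artificialPref I I') R .openSeat).filter
          fun k => E.score s j < E.score s k).card) ∧
    ∀ j, (j, SeatType.reservedSeat) ∈ R → E.reserve s (E.type j) ≤
      (E.typeRivals s (applicants (artificialPref I I') R .reservedSeat) j).card := by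
  refine rejections_induction (P := fun R => (∀ j, (j, SeatType.openSeat) ∈ R →
      E.capacity s -
          (E.simFlexReserved s (applicants (artificialPref I I') R .reservedSeat)).card ≤
        ((applicants (artificialPref I I') R .openSeat).filter
          fun k => E.score s j < E.score s k).card) ∧
    ∀ j, (j, SeatType.reservedSeat) ∈ R → E.reserve s (E.type j) ≤
      (E.typeRivals s (applicants (artificialPref I I') R .reservedSeat) j).card) (by simp) ?_ n
  rintro R ⟨ho, hr⟩
  have hR : R ⊆ daRound (E.simFlex s) (artificialPref I I') R := Finset.subset_union_left
  have hsel : ∀ k t, k ∈ applicants (artificialPref I I') R t → (k, t) ∉ R →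
      (k, t) ∈ selection (E.simFlex s) (artificialPref I I') R →
      (k, t) ∉ daRound (E.simFlex s) (artificialPref I I') R := by
    intro k t _ h1 h2 h3
    rcases mem_daRound.1 h3 with h | h
    · exact h1 h
    · exact h.2 h2
  -- Those tentatively admitted still stand at the same subschool in the next round.
  have hres : E.simFlexReserved s (applicants (artificialPref I I') R .reservedSeat) ⊆
      applicants (artificialPref I I') (daRound (E.simFlex s) (artificialPref I I') R)
        .reservedSeat := by
    intro k hk
    have hka := E.simFlexReserved_subset s _ hk
    have hka' := (mem_applicants_reserved hd).1 hka
    rw [mem_applicants_reserved hd]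
    exact ⟨hsel k _ hka hka'.1 ((E.mem_simFlex_reserved s).2 hk),
      hka'.2.imp_right fun h => ⟨h.1, hR h.2⟩⟩
  have hopen : E.topRanked s (E.capacity s -
        (E.simFlexReserved s (applicants (artificialPref I I') R .reservedSeat)).card)
        (applicants (artificialPref I I') R .openSeat) ⊆
      applicants (artificialPref I I') (daRound (E.simFlex s) (artificialPref I I') R)
        .openSeat := by
    intro k hk
    have hka := ((E.mem_topRanked s).1 hk).1
    have hka' := (mem_applicants_open hd).1 hka
    rw [mem_applicants_open hd]
    exact ⟨hsel k _ hka hka'.1 ((E.mem_simFlex_open s).2 hk),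
      hka'.2.imp_right fun h => ⟨h.1, hR h.2⟩⟩
  constructor
  · intro j hj
    -- The admitted students above `j` already fill the open seats of this round, and the next round
    -- has no more open seats because the reserved count does not drop.
    have h1 := le_card_above_topRanked E s (show _ ≤ _ from by
      rcases mem_daRound.1 hj with hj | ⟨hja, hj⟩
      · exact ho j hj
      · exact (not_mem_selection_open hja).1 hj)
    have h2 := E.card_simFlexReserved_le_of_subset s hres
    have h3 := Finset.card_le_card
      (Finset.filter_subset_filter (fun k => E.score s j < E.score s k) hopen)
    omega
  · intro j hj
    have h1 := le_card_typeRivals_simFlexReserved E s (show _ ≤ _ from by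
      rcases mem_daRound.1 hj with hj | ⟨hja, hj⟩
      · exact hr j hj
      · exact (not_mem_selection_reserved hja).1 hj)
    exact h1.trans (Finset.card_le_card (E.typeRivals_mono s hres j))

/-- The students who are chosen under `C*` are those whom deferred acceptance has not rejected from
both subschools. -/
theorem mem_chosen_cStar (hd : Disjoint I I') {j : Student} :
    j ∈ chosen (E.cStar s I I') ↔
      (j ∈ I ∨ j ∈ I') ∧ ∃ t, (j, t) ∉ rejections (E.simFlex s) (artificialPref I I')
        (Fintype.card (Student × SeatType)) := by
  have hfix := daRound_rejections (E.simFlex s) (artificialPref I I')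
  rw [cStar, deferredAcceptance]
  set R := rejections (E.simFlex s) (artificialPref I I') (Fintype.card (Student × SeatType))
  have hsel : ∀ t, j ∈ applicants (artificialPref I I') R t → (j, t) ∉ R →
      (j, t) ∈ selection (E.simFlex s) (artificialPref I I') R := by
    intro t h1 h2
    by_contra h3
    exact h2 (hfix ▸ mem_daRound.2 (Or.inr ⟨h1, h3⟩))
  simp only [chosen, Finset.mem_image]
  constructor
  · rintro ⟨⟨k, t⟩, hk, rfl⟩
    cases t
    · have := ((E.mem_topRanked s).1 ((E.mem_simFlex_open s).1 hk)).1
      rw [mem_applicants_open hd] at this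
      exact ⟨this.2.imp_right And.left, _, this.1⟩
    · have := E.simFlexReserved_subset s _ ((E.mem_simFlex_reserved s).1 hk)
      rw [mem_applicants_reserved hd] at this
      exact ⟨(this.2.imp_right And.left).symm, _, this.1⟩
  · rintro ⟨hU, ht⟩
    have : ∃ t, j ∈ applicants (artificialPref I I') R t ∧ (j, t) ∉ R := by
      by_cases ho : (j, SeatType.openSeat) ∈ R
      · have hr : (j, SeatType.reservedSeat) ∉ R := by
          obtain ⟨t, ht⟩ := ht
          cases t
          · exact absurd ho ht
          · exact ht
        exact ⟨.reservedSeat,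
          (mem_applicants_reserved hd).2 ⟨hr, hU.symm.imp_right fun h => ⟨h, ho⟩⟩, hr⟩
      · by_cases hr : (j, SeatType.reservedSeat) ∈ R
        · exact ⟨.openSeat, (mem_applicants_open hd).2 ⟨ho, hU.imp_right fun h => ⟨h, hr⟩⟩, ho⟩
        · rcases hU with h | h
          · exact ⟨.openSeat, (mem_applicants_open hd).2 ⟨ho, Or.inl h⟩, ho⟩
          · exact ⟨.reservedSeat, (mem_applicants_reserved hd).2 ⟨hr, Or.inl h⟩, hr⟩
    obtain ⟨t, h1, h2⟩ := this
    exact ⟨_, hsel t h1 h2, rfl⟩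

theorem cutoffChosen_subset_chosen_cStar (hd : Disjoint I I') {c : ℕ}
    (hc : (E.cutoffChosen s I I' c).card ≤ E.capacity s) :
    E.cutoffChosen s I I' c ⊆ chosen (E.cStar s I I') := by
  intro j hj
  obtain ⟨ho, hr⟩ := rejections_of_card_cutoffChosen_le hd hc (Fintype.card (Student × SeatType))
  refine (mem_chosen_cStar hd).2 ⟨mem_union_of_mem_cutoffChosen hj, ?_⟩
  rcases mem_cutoffChosen.1 hj with h | h
  · exact ⟨.openSeat, fun h' => by have := ho j h'; omega⟩
  · exact ⟨.reservedSeat, fun h' => hr j h' h⟩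

theorem card_chosen_simFlex_le (J J' : Finset Student) :
    (chosen (E.simFlex s J J')).card ≤ E.capacity s := by
  have h1 : (chosen (E.simFlex s J J')).card ≤ (E.simFlex s J J').card := Finset.card_image_le
  have h2 := Finset.card_union_le
    (E.topRanked s (E.capacity s - (E.simFlexReserved s J').card) J ×ˢ {SeatType.openSeat})
    (E.simFlexReserved s J' ×ˢ {SeatType.reservedSeat})
  have h3 := E.card_topRanked_le s (E.capacity s - (E.simFlexReserved s J').card) J
  have h4 := E.card_simFlexReserved_lt s J'
  simp only [Finset.card_product, Finset.card_singleton, mul_one] at h2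
  have h5 : (E.simFlex s J J').card ≤ _ := h2
  omega

/-- When the procedure has stopped, everyone standing at a subschool is admitted there, and everyone
rejected by `s^o` ranks below all who stand there. A cutoff therefore separates the two groups. -/
theorem exists_chosen_cStar_eq_cutoffChosen (hd : Disjoint I I') :
    ∃ c, chosen (E.cStar s I I') = E.cutoffChosen s I I' c := by
  have hfix := daRound_rejections (E.simFlex s) (artificialPref I I')
  have hmem := fun j => mem_chosen_cStar (E := E) (s := s) hd (j := j)
  obtain ⟨ho, hr⟩ := le_card_applicants_of_mem_rejections (E := E) (s := s) hd
    (Fintype.card (Student × SeatType))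
  set R := rejections (E.simFlex s) (artificialPref I I') (Fintype.card (Student × SeatType))
  set J := applicants (artificialPref I I') R .openSeat with hJ
  set J' := applicants (artificialPref I I') R .reservedSeat with hJ'
  have hselo : ∀ j ∈ J, (J.filter fun k => E.score s j < E.score s k).card <
      E.capacity s - (E.simFlexReserved s J').card := by
    intro j hj
    by_contra h
    have h1 : (j, SeatType.openSeat) ∉ selection (E.simFlex s) (artificialPref I I') R :=
      (not_mem_selection_open hj).2 (not_lt.1 h)
    exact ((mem_applicants_open hd).1 hj).1 (hfix ▸ mem_daRound.2 (Or.inr ⟨hj, h1⟩))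
  have hselr : ∀ j ∈ J', (E.typeRivals s J' j).card < E.reserve s (E.type j) := by
    intro j hj
    by_contra h
    have h1 : (j, SeatType.reservedSeat) ∉ selection (E.simFlex s) (artificialPref I I') R :=
      (not_mem_selection_reserved hj).2 (not_lt.1 h)
    exact ((mem_applicants_reserved hd).1 hj).1 (hfix ▸ mem_daRound.2 (Or.inr ⟨hj, h1⟩))
  have hlto : ∀ j, (j, SeatType.openSeat) ∈ R → ∀ k ∈ J, E.score s j < E.score s k := by
    intro j hj k hk
    by_contra h
    have h1 := ho j hj
    have h2 := hselo k hk
    have h3 : (J.filter fun l => E.score s j < E.score s l).card ≤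
        (J.filter fun l => E.score s k < E.score s l).card := by
      refine Finset.card_le_card fun l => ?_
      simp only [Finset.mem_filter]
      exact fun hl => ⟨hl.1, by omega⟩
    omega
  have hltr : ∀ j, (j, SeatType.reservedSeat) ∈ R → ∀ k ∈ J', E.type k = E.type j →
      E.score s j < E.score s k := by
    intro j hj k hk ht
    by_contra h
    have h1 := hr j hj
    have h2 := hselr k hk
    rw [ht] at h2
    have h3 : (E.typeRivals s J' j).card ≤ (E.typeRivals s J' k).card := by
      refine Finset.card_le_card fun l => ?_
      simp only [mem_typeRivals]
      exact fun hl => ⟨hl.1, hl.2.1.trans ht.symm, by omega⟩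
    omega
  -- One more than the best score rejected by `s^o`; if there is no such rejection, the supremum is
  -- `0` and the open seats are closed to no one.
  let c := (Finset.univ.filter fun j => (j, SeatType.openSeat) ∈ R).sup fun j => E.score s j + 1
  have hcR : ∀ j, (j, SeatType.openSeat) ∈ R → E.score s j < c := by
    intro j hj
    exact Finset.le_sup (f := fun j => E.score s j + 1)
      (show j ∈ Finset.univ.filter fun j => (j, SeatType.openSeat) ∈ R by simpa using hj)
  have hcJ : ∀ j ∈ J, c ≤ E.score s j := by
    intro j hj
    refine Finset.sup_le fun k hk => ?_
    exact hlto k (by simpa using hk) j hj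
  have hD : ∀ j, j ∈ E.reservedDemand s I I' c ↔ j ∈ I' ∨ j ∈ I ∧ (j, SeatType.openSeat) ∈ R := by
    intro j
    rw [mem_reservedDemand]
    refine or_congr_right (and_congr_right fun h => ⟨fun h' => ?_, hcR j⟩)
    by_contra hn
    have := hcJ j ((mem_applicants_open hd).2 ⟨hn, Or.inl h⟩)
    omega
  have hJD : J' ⊆ E.reservedDemand s I I' c := fun j hj =>
    (hD j).2 ((mem_applicants_reserved hd).1 hj).2
  -- The demand exceeds `J'` only by students rejected by `s^r`. They rank below all members of `J'`
  -- of their type, who already fill the quota, so their presence changes nothing.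
  have hres : ∀ j, j ∈ E.simFlexReserved s (E.reservedDemand s I I' c) ↔ j ∈ J' := by
    intro j
    constructor
    · intro hj
      by_contra hn
      have hjD := (hD j).1 (E.simFlexReserved_subset s _ hj)
      have hjR : (j, SeatType.reservedSeat) ∈ R := by
        by_contra h
        exact hn ((mem_applicants_reserved hd).2 ⟨h, hjD⟩)
      have h1 := hr j hjR
      have h2 := ((E.mem_simFlexReserved s).1 hj).2
      have h3 := Finset.card_le_card (E.typeRivals_mono s hJD j)
      omega
    · intro hj
      refine (E.mem_simFlexReserved s).2 ⟨hJD hj, ?_⟩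
      refine lt_of_le_of_lt (Finset.card_le_card fun l => ?_) (hselr j hj)
      simp only [mem_typeRivals]
      rintro ⟨hl, hl1, hl2⟩
      refine ⟨?_, hl1, hl2⟩
      by_contra hn
      have hlR : (l, SeatType.reservedSeat) ∈ R := by
        by_contra h
        exact hn ((mem_applicants_reserved hd).2 ⟨h, (hD l).1 hl⟩)
      have := hltr l hlR j hj hl1.symm
      omega
  refine ⟨c, Finset.ext fun j => ?_⟩
  rw [hmem, mem_cutoffChosen, hres]
  constructor
  · rintro ⟨hU, ht⟩
    by_cases hj : j ∈ J'
    · exact Or.inr hj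
    refine Or.inl ⟨hU, hcJ j ?_⟩
    rw [hJ', mem_applicants_reserved hd] at hj
    rw [hJ, mem_applicants_open hd]
    have ho' : (j, SeatType.openSeat) ∉ R := by
      intro h
      obtain ⟨t, ht⟩ := ht
      cases t
      · exact ht h
      · exact hj ⟨ht, hU.symm.imp_right fun h' => ⟨h', h⟩⟩
    refine ⟨ho', ?_⟩
    by_contra h
    push Not at h
    exact hj ⟨fun h' => h.2 (hU.resolve_left h.1) h', Or.inl (hU.resolve_left h.1)⟩
  · rintro (⟨hU, hjc⟩ | hj)
    · exact ⟨hU, .openSeat, fun h => by have := hcR j h; omega⟩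
    · rw [hJ', mem_applicants_reserved hd] at hj
      exact ⟨(hj.2.imp_right And.left).symm, _, hj.1⟩

end Outcome

end SchoolChoice

theorem mainTheorem8 {Student School MType : Type*} [Fintype Student] [DecidableEq Student]
    [Fintype MType] [DecidableEq MType] (E : SchoolChoice Student School MType) (s : School)
    (I I' : Finset Student) (hdisj : Disjoint I I') (i : Student) (hi : i ∈ I') :
    SchoolChoice.chosen (E.cStar s I I') ∩ E.ofType (E.type i) ⊆
      SchoolChoice.chosen (E.cStar s (I ∪ {i}) (I' \ {i})) ∩ E.ofType (E.type i) := by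
  have hd : Disjoint (I ∪ {i}) (I' \ {i}) := by
    rw [Finset.disjoint_left] at hdisj ⊢
    intro j
    simp only [Finset.mem_union, Finset.mem_sdiff, Finset.mem_singleton]
    rintro (h | h) h'
    · exact hdisj h h'.1
    · exact h'.2 h
  obtain ⟨c, hc⟩ := SchoolChoice.exists_chosen_cStar_eq_cutoffChosen (E := E) (s := s) hdisj
  have hcard : (E.cutoffChosen s I I' c).card ≤ E.capacity s :=
    hc ▸ SchoolChoice.card_chosen_simFlex_le _ _
  obtain ⟨c', hcap, hc'⟩ := SchoolChoice.exists_cutoffChosen_switch hi hcard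
  intro j hj
  rw [Finset.mem_inter, hc] at hj
  have ht : E.type j = E.type i := by simpa [SchoolChoice.ofType] using hj.2
  exact Finset.mem_inter.2
    ⟨SchoolChoice.cutoffChosen_subset_chosen_cStar hd hcap (hc' j hj.1 ht), hj.2⟩
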